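/- All graphs are finite and may have parallel edges but no loops. For a graph $G$ and $X\subseteq V(G)$, $\delta(X)$ denotes the set of edges with exactly one endpoint in $X$. **Immersions.** $G$ contains a graph $H$ as a (weak) immersion if there are an injective map $\pi_v:V(H)\to V(G)$ and a map $\pi_e$ assigning to each edge $f\in E(H)$ with endpoints $x,y$ a path $\pi_e(f)$ of $G$ with endpoints $\pi_v(x),\pi_v(y)$, such that $\pi_e(f)$ and $\pi_e(f')$ have no edge in common whenever $f\neq f'$. **Walls.** For a positive integer $n$ the wall $H_n$ has vertices $v^i_j$ ($1\le i,j\le n$); its edges are $v^i_jv^i_{j+1}$ for $1\le i\le n$, $1\le j<n$, and $v^i_jv^{i+1}_j$ for $1\le i<n$, $1\le j\le n$ with $i,j$ both odd or both even. **Tree-cut width.** A tree-cut decomposition of $G$ is a pair $(T,\mathcal X)$ where $T$ is a finite tree and $\mathcal X=\{X_t:t\in V(T)\}$ is a family of pairwise disjoint, possibly empty, subsets of $V(G)$ with union $V(G)$. Its adhesion is the maximum over the edges $uv$ of $T$ of $\left|\delta\left(\bigcup_{t\in V(T_v)}X_t\right)\right|$, where $T_v$ is the component of $T-uv$ containing $v$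 (and $0$ if $T$ has no edge). The torso $G_t$ at $t\in V(T)$ is obtained from $G$ by consolidating, for each component $T_i$ of $T-t$, the set $\bigcup_{s\in V(T_i)}X_s$, i.e. identifying it to a single vertex and deleting all edges with both endpoints in it. For a graph $J$ and $X\subseteq V(J)$, the 3-center of $(J,X)$ is the graph $H$, maximum with respect to containment as an immersion, such that there is an immersion $(\pi_v,\pi_e)$ of $H$ in $J$ with $X\subseteq\pi_v(V(H))$ and with $\pi_v(x)\in X$ for every $x\in V(H)$ of degree at most $2$ in $H$. The width of $(T,\mathcal X)$ is the maximum of its adhesion and of the numbers $|V(\bar G_t)|$, $t\in V(T)$, where $\bar G_t$ is the 3-center of $(G_t,X_t)$. The tree-cut width of $G$ is the minimum width of a tree-cut decomposition of $G$. **Theorem.** Let $G$ be a graph and let $r\ge 3$ be an integer. If $G$ contains $H_{2r^2}$ as an immersion, then the tree-cut width of $G$ is at least $r$. -/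

import Mathlib

open scoped Graph

namespace Graph

universe u v u' v' w

variable {α : Type u} {β : Type v} {γ : Type u'} {δ : Type v'}

/-- The graphs considered are finite and may have parallel edges but no loops. -/
structure IsFiniteLoopless (G : Graph α β) : Prop where
  loopless : G.Loopless
  finite_vertexSet : V(G).Finite
  finite_edgeSet : E(G).Finite

/-- The degree of `x`: the number of edges incident with `x` (for a graph without loops). -/
noncomputable def deg (G : Graph α β) (x : α) : ℕ := (G.incidenceSet x).ncard

/-- `δ(X)`: the set of edges with exactly one endpoint in `X`. -/
def cut (G : Graph α β) (X : Set α) : Set β :=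
  {e | ∃ x y, G.IsLink e x y ∧ x ∈ X ∧ y ∉ X}

/-- `G.IsWalkFrom x p y`: the list `p = [(e₁, x₁), …, (eₖ, xₖ)]` describes a walk
`x, e₁, x₁, …, eₖ, xₖ = y` in `G`. -/
def IsWalkFrom (G : Graph α β) : α → List (β × α) → α → Prop
  | x, [], y => x ∈ V(G) ∧ x = y
  | x, (e, z) :: p, y => G.IsLink e x z ∧ G.IsWalkFrom z p y

/-- A path with endpoints `x` and `y`: a walk that repeats no vertex. -/
def IsPathFrom (G : Graph α β) (x : α) (p : List (β × α)) (y : α) : Prop :=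
  G.IsWalkFrom x p y ∧ (x :: p.map Prod.snd).Nodup

/-- `(πv, πe)` is a (weak) immersion of `H` in `G`. -/
structure IsImmersion (G : Graph α β) (H : Graph γ δ)
    (πv : γ → α) (πe : δ → List (β × α)) : Prop where
  mapsTo : Set.MapsTo πv V(H) V(G)
  injOn : Set.InjOn πv V(H)
  isPath : ∀ f ∈ E(H), ∃ x y, H.IsLink f x y ∧ G.IsPathFrom (πv x) (πe f) (πv y)
  edgeDisjoint : ∀ f ∈ E(H), ∀ f' ∈ E(H), f ≠ f' →
    List.Disjoint ((πe f).map Prod.fst) ((πe f').map Prod.fst)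

/-- `G` contains `H` as a (weak) immersion. -/
def Immerses (G : Graph α β) (H : Graph γ δ) : Prop :=
  ∃ (πv : γ → α) (πe : δ → List (β × α)), G.IsImmersion H πv πe

/-- `H` is a graph with an immersion in `G` such that every vertex of `X` is a branch vertex and
every vertex of `H` of degree at most two is mapped into `X`. -/
def IsThreeCenterCandidate (G : Graph α β) (X : Set α) (H : Graph γ δ) : Prop :=
  H.IsFiniteLoopless ∧ ∃ (πv : γ → α) (πe : δ → List (β × α)), G.IsImmersion H πv πe ∧
    X ⊆ πv '' V(H) ∧ ∀ x ∈ V(H), H.deg x ≤ 2 → πv x ∈ X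

/-- `H` is the 3-center of `(G, X)`: the maximum candidate with respect to containment as an
immersion. Every finite graph is isomorphic to some `H' : Graph ℕ ℕ`. -/
def IsThreeCenter (G : Graph α β) (X : Set α) (H : Graph γ δ) : Prop :=
  G.IsThreeCenterCandidate X H ∧
    ∀ H' : Graph ℕ ℕ, G.IsThreeCenterCandidate X H' → H.Immerses H'

/-- The number of vertices of the 3-center of `(G, X)`. Any two 3-centers immerse each other, so
the set below has at most one element. -/
noncomputable def threeCenterOrder (G : Graph α β) (X : Set α) : ℕ :=
  sSup {n | ∃ H : Graph ℕ ℕ, G.IsThreeCenter X H ∧ n = V(H).ncard}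

/-- Identify the vertices of `G` in each fibre of `f` and delete all edges with both endpoints in
the same fibre. For a graph without loops this consolidates each fibre of `f`. -/
def consolidate (f : α → γ) (G : Graph α β) : Graph γ β :=
  (G.map f).deleteEdges {e | ∃ x, (G.map f).IsLoopAt e x}

/-- A tree-cut decomposition of `G` with tree on the vertex type `τ`. A near-partition of `V(G)`
indexed by `τ` is given by the function sending each vertex of `G` to the index of the part that
contains it (the values of `node` outside `V(G)` are irrelevant). -/
structure TreeCutDecomposition (G : Graph α β) (τ : Type w) where
  tree : SimpleGraph τ
  isTree : tree.IsTree
  node : α → τ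

namespace TreeCutDecomposition

variable {G : Graph α β} {τ : Type w} (D : G.TreeCutDecomposition τ)

/-- The bag `X_t`. -/
def bag (t : τ) : Set α := {x ∈ V(G) | D.node x = t}

/-- For an edge `uv` of the tree `T`, the union of the bags `X_t` over all `t` in the component
of `T - uv` that contains `v`. -/
def side (u v : τ) : Set α :=
  ⋃ t ∈ {t | (D.tree.deleteEdges {s(u, v)}).Reachable v t}, D.bag t

/-- The adhesion (`0` if the tree has no edge, as `sSup ∅ = 0` in `ℕ`). -/
noncomputable def adhesion : ℕ :=
  sSup {k | ∃ u v, D.tree.Adj u v ∧ k = (G.cut (D.side u v)).ncard}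

open Classical in
/-- The map that fixes every vertex of the bag `X_t` and sends every other vertex to the component
of `T - t` that contains its node. -/
noncomputable def torsoMap (t : τ) (x : α) :
    α ⊕ (D.tree.induce {t}ᶜ).ConnectedComponent :=
  if h : D.node x = t then Sum.inl x
  else Sum.inr ((D.tree.induce {t}ᶜ).connectedComponentMk ⟨D.node x, h⟩)

/-- The torso of `G` at `t`: for each component `T_i` of `T - t`, the union of the bags over `T_i`
is consolidated to a single vertex. -/
noncomputable def torso (t : τ) :
    Graph (α ⊕ (D.tree.induce {t}ᶜ).ConnectedComponent) β :=
  consolidate (D.torsoMap t) G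

/-- The core vertices of the torso at `t`, that is, the bag `X_t`. -/
def core (t : τ) : Set (α ⊕ (D.tree.induce {t}ᶜ).ConnectedComponent) :=
  Sum.inl '' D.bag t

/-- The width: the maximum of the adhesion and the numbers of vertices of the 3-centers of
the torsos on the bags. -/
noncomputable def width : ℕ :=
  max D.adhesion (⨆ t : τ, (D.torso t).threeCenterOrder (D.core t))

end TreeCutDecomposition

/-- The tree-cut width: the minimum width of a tree-cut decomposition (over a finite tree). -/
noncomputable def treeCutWidth (G : Graph α β) : ℕ :=
  sInf {k | ∃ (τ : Type) (_ : Finite τ) (D : G.TreeCutDecomposition τ), k = D.width}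

/-- The `r`-wall as a simple graph. The pair `(i, j)` stands for the vertex `v_{j+1}^{i+1}`,
that is, the `(j+1)`-st vertex of the `(i+1)`-st horizontal path. -/
def wallSimpleGraph (r : ℕ) : SimpleGraph (Fin r × Fin r) :=
  SimpleGraph.fromRel fun p q =>
    (p.1 = q.1 ∧ p.2.val + 1 = q.2.val) ∨
    (p.2 = q.2 ∧ p.1.val + 1 = q.1.val ∧
      ((Odd (p.1.val + 1) ∧ Odd (p.2.val + 1)) ∨ (Even (p.1.val + 1) ∧ Even (p.2.val + 1))))

/-- The `r`-wall `H_r`. -/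
def wall (r : ℕ) : Graph (Fin r × Fin r) (Sym2 (Fin r × Fin r)) :=
  Graph.ofSimpleGraph (wallSimpleGraph r)

end Graph

/-! Put M = r². In the wall `H_{2M}` take the M - 2 vertices `wallDiagonal M k`. Counting
edge-disjoint paths gives two facts. A cut with c < M edges leaves an uncut zigzag path (a pair of
adjacent columns), which meets every row; all uncut rows therefore lie on one side, and at most c
diagonal vertices lie on the other (`wall_cut_dichotomy`). A cut separating two diagonal vertices
has at least three edges (`three_le_ncard_wall_cut`), because each such vertex has three
edge-disjoint routes to uncut rows.

Suppose a tree-cut decomposition has width less than r. Its adhesion is at most r - 1, so no tree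
edge has more than r - 1 diagonal vertices on both sides. Orient an edge towards a side with more
than r - 1 of them, if there is one; at a sink t, every component of T - t holds at most r - 1.
Since r² - 2 > (r - 1)², the diagonal vertices have at least r distinct images in the torso at t.
Cuts of the torso pull back to cuts of the wall that are no larger, so any cut separating two of
these images has at least three edges.

It remains to see that the 3-center keeps such a set S (`ncard_le_threeCenterOrder`). A vertex of
degree at most 2 outside X is never a branch vertex and never in S; deleting or suppressing it
changes neither the candidates nor the connectivity of S. When no such vertex is left, the graph is
its own 3-center. -/

namespace Graph

/-! ### Immersions encoded by disjoint edge sets, and monotonicity of cuts -/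

section EdgeImmersion

variable {α β γ δ : Type*}

/-- `y` can be reached from `x` in `G` using only edges of `P`. -/
def ReachableIn (G : Graph α β) (P : Set β) : α → α → Prop :=
  Relation.ReflTransGen fun x y => ∃ e ∈ P, G.IsLink e x y

lemma ReachableIn.of_isLink {G : Graph α β} {P : Set β} {e : β} {x y : α} (he : e ∈ P)
    (h : G.IsLink e x y) : G.ReachableIn P x y :=
  Relation.ReflTransGen.single ⟨e, he, h⟩

lemma ReachableIn.symm {G : Graph α β} {P : Set β} {x y : α} (h : G.ReachableIn P x y) :
    G.ReachableIn P y x := by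
  induction h with
  | refl => exact .refl
  | tail _ h ih =>
    obtain ⟨e, he, hl⟩ := h
    exact .head ⟨e, he, hl.symm⟩ ih

lemma ReachableIn.trans {G : Graph α β} {P : Set β} {x y z : α} (h : G.ReachableIn P x y)
    (h' : G.ReachableIn P y z) : G.ReachableIn P x z :=
  Relation.ReflTransGen.trans h h'

lemma ReachableIn.map {G : Graph α β} {G' : Graph γ δ} {P : Set β} {P' : Set δ} {g : α → γ}
    (hg : ∀ e ∈ P, ∀ x y, G.IsLink e x y → G'.ReachableIn P' (g x) (g y)) {x y : α}
    (h : G.ReachableIn P x y) : G'.ReachableIn P' (g x) (g y) := by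
  induction h with
  | refl => exact .refl
  | tail _ h ih =>
    obtain ⟨e, he, hl⟩ := h
    exact ih.trans (hg e he _ _ hl)

/-- A set of edges connecting a vertex in `B` to one outside `B` contains an edge of `δ(B)`. -/
lemma ReachableIn.exists_mem_cut {G : Graph α β} {P : Set β} {x y : α} {B : Set α}
    (h : G.ReachableIn P x y) (hx : x ∈ B) (hy : y ∉ B) : ∃ e ∈ P, e ∈ G.cut B := by
  induction h with
  | refl => exact absurd hx hy
  | @tail b c _ h ih =>
    by_cases hb : b ∈ B
    · obtain ⟨e, he, hl⟩ := h
      exact ⟨e, he, b, c, hl, hb, hy⟩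
    · exact ih hb

lemma IsWalkFrom.reachableIn {G : Graph α β} {p : List (β × α)} {x y : α}
    (h : G.IsWalkFrom x p y) {P : Set β} (hP : ∀ e ∈ p.map Prod.fst, e ∈ P) :
    G.ReachableIn P x y := by
  induction p generalizing x with
  | nil => exact h.2 ▸ .refl
  | cons q p ih =>
    obtain ⟨e, z⟩ := q
    exact (ReachableIn.of_isLink (hP e (by simp)) h.1).trans
      (ih h.2 fun e' he' => hP e' (by simp only [List.map_cons, List.mem_cons]; exact .inr he'))

lemma IsPathFrom.exists_suffix {G : Graph α β} {p : List (β × α)} {z y : α}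
    (h : G.IsPathFrom z p y) {x : α} (hx : x ∈ z :: p.map Prod.snd) :
    ∃ q, G.IsPathFrom x q y ∧ ∀ e ∈ q.map Prod.fst, e ∈ p.map Prod.fst := by
  induction p generalizing z with
  | nil =>
    obtain rfl : x = z := by simpa using hx
    exact ⟨[], h, by simp⟩
  | cons c p ih =>
    obtain ⟨e, w⟩ := c
    rcases List.mem_cons.1 hx with rfl | hx
    · exact ⟨_, h, fun _ h => h⟩
    · obtain ⟨q, hq, hqp⟩ := ih (z := w) ⟨h.1.2, (List.nodup_cons.1 h.2).2⟩ hx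
      exact ⟨q, hq, fun e he => List.mem_cons_of_mem _ (hqp e he)⟩

/-- Prepend edges one at a time; when the new vertex already occurs on the path, keep only the
suffix that starts there. -/
lemma ReachableIn.exists_isPathFrom {G : Graph α β} {P : Set β} {x y : α}
    (h : G.ReachableIn P x y) (hy : y ∈ V(G)) :
    ∃ p, G.IsPathFrom x p y ∧ ∀ e ∈ p.map Prod.fst, e ∈ P := by
  induction h using Relation.ReflTransGen.head_induction_on with
  | refl => exact ⟨[], ⟨⟨hy, rfl⟩, by simp⟩, by simp⟩
  | @head x z h _ ih =>
    obtain ⟨e, he, hl⟩ := h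
    obtain ⟨p, hp, hpP⟩ := ih
    by_cases hx : x ∈ z :: p.map Prod.snd
    · obtain ⟨q, hq, hqp⟩ := hp.exists_suffix hx
      exact ⟨q, hq, fun e he => hpP e (hqp e he)⟩
    · refine ⟨(e, z) :: p, ⟨⟨hl, hp.1⟩, List.nodup_cons.2 ⟨hx, hp.2⟩⟩, ?_⟩
      intro e' he'
      rcases List.mem_cons.1 he' with rfl | he'
      · exact he
      · exact hpP e' he'

/-- An immersion given by pairwise disjoint edge sets, the set of `f` connecting the images of the
endpoints of `f`. -/
structure IsEdgeImmersion (G : Graph α β) (H : Graph γ δ) (πv : γ → α) (P : δ → Set β) :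
    Prop where
  mapsTo : Set.MapsTo πv V(H) V(G)
  injOn : Set.InjOn πv V(H)
  reachableIn : ∀ f x y, H.IsLink f x y → G.ReachableIn (P f) (πv x) (πv y)
  disjoint : ∀ f ∈ E(H), ∀ f' ∈ E(H), ∀ e, e ∈ P f → e ∈ P f' → f = f'

lemma IsImmersion.isEdgeImmersion {G : Graph α β} {H : Graph γ δ} {πv : γ → α}
    {πe : δ → List (β × α)} (h : G.IsImmersion H πv πe) :
    G.IsEdgeImmersion H πv fun f => {e | e ∈ (πe f).map Prod.fst} where
  mapsTo := h.mapsTo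
  injOn := h.injOn
  reachableIn f x y hf := by
    obtain ⟨x', y', hl, hp⟩ := h.isPath f hf.edge_mem
    have hr := hp.1.reachableIn (P := {e | e ∈ (πe f).map Prod.fst}) fun _ h => h
    rcases hl.eq_and_eq_or_eq_and_eq hf with ⟨rfl, rfl⟩ | ⟨rfl, rfl⟩
    · exact hr
    · exact hr.symm
  disjoint f hf f' hf' e he he' := by
    by_contra hne
    exact h.edgeDisjoint f hf f' hf' hne he he'

/-- Edge sets may contain superfluous edges, which makes them easier to modify than paths; genuine
paths are extracted only here. -/
lemma IsEdgeImmersion.exists_isImmersion {G : Graph α β} {H : Graph γ δ} {πv : γ → α}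
    {P : δ → Set β} (h : G.IsEdgeImmersion H πv P) : ∃ πe, G.IsImmersion H πv πe := by
  have key : ∀ f, ∃ p : List (β × α), f ∈ E(H) →
      (∃ x y, H.IsLink f x y ∧ G.IsPathFrom (πv x) p (πv y)) ∧ ∀ e ∈ p.map Prod.fst, e ∈ P f := by
    intro f
    by_cases hf : f ∈ E(H)
    · obtain ⟨x, y, hl⟩ := exists_isLink_of_mem_edgeSet hf
      obtain ⟨p, hp, hpP⟩ := (h.reachableIn f x y hl).exists_isPathFrom (h.mapsTo hl.right_mem)
      exact ⟨p, fun _ => ⟨⟨x, y, hl, hp⟩, hpP⟩⟩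
    · exact ⟨[], fun hf' => absurd hf' hf⟩
  choose πe hπe using key
  exact ⟨πe, h.mapsTo, h.injOn, fun f hf => (hπe f hf).1, fun f hf f' hf' hne e he he' =>
    hne (h.disjoint f hf f' hf' e ((hπe f hf).2 e he) ((hπe f' hf').2 e he'))⟩

lemma cut_subset_edgeSet (G : Graph α β) (B : Set α) : G.cut B ⊆ E(G) := by
  rintro e ⟨x, y, h, -⟩
  exact h.edge_mem

lemma IsFiniteLoopless.finite_cut {G : Graph α β} (hG : G.IsFiniteLoopless) (B : Set α) :
    (G.cut B).Finite :=
  hG.finite_edgeSet.subset (G.cut_subset_edgeSet B)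

/-- Cuts do not get smaller when passing from an immersed graph to the host graph. -/
lemma IsEdgeImmersion.ncard_cut_le {G : Graph α β} {H : Graph γ δ} {πv : γ → α}
    {P : δ → Set β} (h : G.IsEdgeImmersion H πv P) (hG : E(G).Finite) {A : Set γ} {B : Set α}
    (hAB : ∀ x ∈ V(H), x ∈ A ↔ πv x ∈ B) : (H.cut A).ncard ≤ (G.cut B).ncard := by
  have key : ∀ f ∈ H.cut A, ∃ e ∈ P f, e ∈ G.cut B := by
    rintro f ⟨x, y, hl, hx, hy⟩
    exact (h.reachableIn f x y hl).exists_mem_cut ((hAB x hl.left_mem).1 hx)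
      fun h => hy ((hAB y hl.right_mem).2 h)
  rcases (H.cut A).eq_empty_or_nonempty with he | ⟨f₀, hf₀⟩
  · simp [he]
  have : Nonempty β := ⟨(key f₀ hf₀).choose⟩
  choose! φ hφ using key
  refine Set.ncard_le_ncard_of_injOn φ (fun f hf => (hφ f hf).2) ?_
    (hG.subset (G.cut_subset_edgeSet B))
  intro f hf f' hf' heq
  exact h.disjoint f (H.cut_subset_edgeSet A hf) f' (H.cut_subset_edgeSet A hf') (φ f)
    (hφ f hf).1 (heq ▸ (hφ f' hf').1)

lemma deg_eq_ncard_cut {G : Graph α β} (hG : G.Loopless) (x : α) :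
    G.deg x = (G.cut {x}).ncard := by
  unfold deg
  congr 1
  ext e
  constructor
  · rintro ⟨y, hy⟩
    exact ⟨x, y, hy, rfl, fun h => hG.not_isLoopAt e x (by rw [Set.mem_singleton_iff.1 h] at hy; exact hy)⟩
  · rintro ⟨x', y, hy, rfl, -⟩
    exact ⟨y, hy⟩

lemma IsEdgeImmersion.deg_le {G : Graph α β} {H : Graph γ δ} {πv : γ → α}
    {P : δ → Set β} (h : G.IsEdgeImmersion H πv P) (hG : E(G).Finite) (hH : H.Loopless) {x : γ}
    (hx : x ∈ V(H)) : H.deg x ≤ (G.cut {πv x}).ncard := by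
  rw [deg_eq_ncard_cut hH]
  refine h.ncard_cut_le hG fun y hy => ?_
  simp only [Set.mem_singleton_iff]
  exact ⟨fun h => h ▸ rfl, fun he => h.injOn hy hx he⟩

lemma isThreeCenterCandidate_iff {G : Graph α β} {X : Set α} {H : Graph γ δ} :
    G.IsThreeCenterCandidate X H ↔ H.IsFiniteLoopless ∧ ∃ (πv : γ → α) (P : δ → Set β),
      G.IsEdgeImmersion H πv P ∧ X ⊆ πv '' V(H) ∧ ∀ x ∈ V(H), H.deg x ≤ 2 → πv x ∈ X := by
  constructor
  · rintro ⟨hH, πv, πe, h, hX⟩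
    exact ⟨hH, πv, _, h.isEdgeImmersion, hX⟩
  · rintro ⟨hH, πv, P, h, hX⟩
    obtain ⟨πe, hπe⟩ := h.exists_isImmersion
    exact ⟨hH, πv, πe, hπe, hX⟩

/-- The vertices of degree at most two outside `X` are not branch vertices. -/
lemma IsEdgeImmersion.ne_of_ncard_cut_le {G : Graph α β} {H : Graph γ δ} {πv : γ → α}
    {P : δ → Set β} (h : G.IsEdgeImmersion H πv P) (hG : E(G).Finite) (hH : H.Loopless)
    {X : Set α} (hX : ∀ x ∈ V(H), H.deg x ≤ 2 → πv x ∈ X) {v : α} (hv : v ∉ X)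
    (hdeg : (G.cut {v}).ncard ≤ 2) {x : γ} (hx : x ∈ V(H)) : πv x ≠ v := by
  rintro rfl
  exact hv (hX x hx ((h.deg_le hG hH hx).trans hdeg))

end EdgeImmersion

/-! ### Existence of the 3-center, and the vertices it must retain -/

section ThreeCenter

variable {α β γ δ : Type*}

/-- Every cut of `G` separating two vertices of `S` has at least three edges. -/
def IsThreeEdgeConnectedSet (G : Graph α β) (S : Set α) : Prop :=
  ∀ A : Set α, (S ∩ A).Nonempty → (S \ A).Nonempty → 3 ≤ (G.cut A).ncard

/-- The copy of `G` obtained by renaming vertices along `g` and edges along `h`. -/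
def relabel (G : Graph α β) (g : α → γ) (h : β → δ)
    (hh : Set.InjOn h E(G)) : Graph γ δ where
  vertexSet := g '' V(G)
  IsLink f x y := ∃ e a b, G.IsLink e a b ∧ h e = f ∧ g a = x ∧ g b = y
  isLink_symm := by
    rintro f -
    refine ⟨?_⟩
    rintro _ _ ⟨e, a, b, hl, rfl, rfl, rfl⟩
    exact ⟨e, b, a, hl.symm, rfl, rfl, rfl⟩
  eq_or_eq_of_isLink_of_isLink := by
    rintro _ _ _ _ _ ⟨e, a, b, hl, rfl, rfl, rfl⟩ ⟨e', a', b', hl', he, rfl, rfl⟩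
    obtain rfl := hh hl'.edge_mem hl.edge_mem he
    rcases hl.left_eq_or_eq hl' with rfl | rfl <;> simp
  left_mem_of_isLink := by
    rintro _ _ _ ⟨e, a, b, hl, rfl, rfl, rfl⟩
    exact ⟨a, hl.left_mem, rfl⟩

section Relabel

variable {G : Graph α β} {g : α → γ} {h : β → δ} {hh : Set.InjOn h E(G)}

lemma edgeSet_relabel_subset : E(G.relabel g h hh) ⊆ h '' E(G) := by
  rintro _ ⟨_, _, e, a, b, hl, rfl, rfl, rfl⟩
  exact ⟨e, hl.edge_mem, rfl⟩

lemma IsFiniteLoopless.relabel (hG : G.IsFiniteLoopless) (hg : Set.InjOn g V(G)) :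
    (G.relabel g h hh).IsFiniteLoopless where
  loopless := by
    refine ⟨?_⟩
    rintro f x ⟨e, a, b, hl, rfl, rfl, hab⟩
    obtain rfl := hg hl.right_mem hl.left_mem hab
    exact hG.loopless.not_isLoopAt _ _ hl
  finite_vertexSet := hG.finite_vertexSet.image g
  finite_edgeSet := (hG.finite_edgeSet.image h).subset edgeSet_relabel_subset

lemma IsEdgeImmersion.relabel {α' β' : Type*} {K : Graph α' β'} {πv : α' → α} {P : β' → Set β}
    (hK : G.IsEdgeImmersion K πv P) (hg : Set.InjOn g V(G)) :
    (G.relabel g h hh).IsEdgeImmersion K (g ∘ πv) fun f => h '' (P f ∩ E(G)) where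
  mapsTo x hx := ⟨_, hK.mapsTo hx, rfl⟩
  injOn x hx y hy hxy := hK.injOn hx hy (hg (hK.mapsTo hx) (hK.mapsTo hy) hxy)
  reachableIn f x y hf := by
    refine (hK.reachableIn f x y hf).map (g := g) fun e he a b hl => ?_
    exact ReachableIn.of_isLink (e := h e) ⟨e, ⟨he, hl.edge_mem⟩, rfl⟩ ⟨e, a, b, hl, rfl, rfl, rfl⟩
  disjoint := by
    rintro f hf f' hf' _ ⟨e, he, rfl⟩ ⟨e', he', heq⟩
    obtain rfl := hh he'.2 he.2 heq
    exact hK.disjoint f hf f' hf' e' he.1 he'.1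

lemma isEdgeImmersion_self : G.IsEdgeImmersion G id fun e => {e} where
  mapsTo _ hx := hx
  injOn _ _ _ _ hxy := hxy
  reachableIn _ _ _ hf := .of_isLink rfl hf
  disjoint := by
    rintro f - f' - e rfl rfl
    rfl

lemma isEdgeImmersion_relabel_self [Nonempty α] (hg : Set.InjOn g V(G)) :
    G.IsEdgeImmersion (G.relabel g h hh) (Function.invFunOn g V(G))
      fun f => {e | e ∈ E(G) ∧ h e = f} where
  mapsTo := by
    rintro _ ⟨a, ha, rfl⟩
    rwa [hg.leftInvOn_invFunOn ha]
  injOn := by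
    rintro _ ⟨a, ha, rfl⟩ _ ⟨b, hb, rfl⟩ hab
    rw [hg.leftInvOn_invFunOn ha, hg.leftInvOn_invFunOn hb] at hab
    rw [hab]
  reachableIn := by
    rintro _ _ _ ⟨e, a, b, hl, rfl, rfl, rfl⟩
    rw [hg.leftInvOn_invFunOn hl.left_mem, hg.leftInvOn_invFunOn hl.right_mem]
    exact .of_isLink ⟨hl.edge_mem, rfl⟩ hl
  disjoint := by
    rintro f - f' - e ⟨-, rfl⟩ ⟨-, rfl⟩
    rfl

end Relabel

/-- If all vertices outside `X` have degree at least three, then `G` is its own 3-center. -/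
lemma exists_isThreeCenter_of_three_le [Nonempty α] {G : Graph α β} (hG : G.IsFiniteLoopless)
    {X : Set α} (hX : X ⊆ V(G)) (hdeg : ∀ v ∈ V(G), v ∉ X → 3 ≤ (G.cut {v}).ncard) :
    ∃ H : Graph ℕ ℕ, G.IsThreeCenter X H ∧ V(H).ncard = V(G).ncard := by
  obtain ⟨g, hg⟩ := Set.countable_iff_exists_injOn.1 hG.finite_vertexSet.countable
  obtain ⟨h, hh⟩ := Set.countable_iff_exists_injOn.1 hG.finite_edgeSet.countable
  have hfin : (G.relabel g h hh).IsFiniteLoopless := hG.relabel hg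
  refine ⟨G.relabel g h hh, ⟨isThreeCenterCandidate_iff.2 ⟨hfin, _, _,
    isEdgeImmersion_relabel_self hg, ?_, ?_⟩, ?_⟩, hg.ncard_image⟩
  · intro x hx
    exact ⟨g x, ⟨x, hX hx, rfl⟩, hg.leftInvOn_invFunOn (hX hx)⟩
  · rintro _ ⟨v, hv, rfl⟩ hle
    rw [hg.leftInvOn_invFunOn hv]
    by_contra hvX
    have h3 := hdeg v hv hvX
    rw [deg_eq_ncard_cut hfin.loopless] at hle
    have hle' : (G.cut {v}).ncard ≤ ((G.relabel g h hh).cut {g v}).ncard :=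
      (isEdgeImmersion_self.relabel hg).ncard_cut_le hfin.finite_edgeSet fun x hx =>
        ⟨fun he => by rw [Set.mem_singleton_iff.1 he]; rfl, fun he => hg hx hv he⟩
    omega
  · intro H' hH'
    obtain ⟨-, πv, P, himm, -⟩ := isThreeCenterCandidate_iff.1 hH'
    obtain ⟨πe, hπe⟩ := (himm.relabel (hh := hh) hg).exists_isImmersion
    exact ⟨_, πe, hπe⟩

/-- The effect of removing a vertex `v` of degree at most two outside `X`. -/
structure IsReduction (G : Graph α β) (X S : Set α) (v : α) (G' : Graph α β) : Prop where
  finiteLoopless : G'.IsFiniteLoopless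
  vertexSet : V(G') = V(G) \ {v}
  candidate_iff : ∀ H : Graph ℕ ℕ, G.IsThreeCenterCandidate X H ↔ G'.IsThreeCenterCandidate X H
  connectedSet : G'.IsThreeEdgeConnectedSet S

lemma IsReduction.isThreeCenter {G G' : Graph α β} {X S : Set α} {v : α}
    (h : G.IsReduction X S v G') {H : Graph ℕ ℕ} (hH : G'.IsThreeCenter X H) :
    G.IsThreeCenter X H :=
  ⟨(h.candidate_iff H).2 hH.1, fun H' hH' => hH.2 H' ((h.candidate_iff H').1 hH')⟩

/-- Move `v` to the side of `A` that contains `a`. -/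
lemma exists_set_mem_iff (A : Set α) {v a : α} (hav : a ≠ v) :
    ∃ B : Set α, (v ∈ B ↔ a ∈ B) ∧ ∀ x ≠ v, x ∈ B ↔ x ∈ A := by
  classical
  refine ⟨{x | if x = v then a ∈ A else x ∈ A}, by simp [hav], fun x hx => by simp [hx]⟩

/-- A cut of the reduced graph says nothing about the removed vertex v, so v may be placed on the
side of its neighbour a before comparing with a cut of G. -/
lemma IsThreeEdgeConnectedSet.of_ncard_cut_le {G G' : Graph α β} {S : Set α} {v a : α}
    (hS : G.IsThreeEdgeConnectedSet S) (hv : v ∉ S) (hav : a ≠ v)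
    (h : ∀ A B : Set α, (v ∈ B ↔ a ∈ B) → (∀ x ≠ v, x ∈ B ↔ x ∈ A) →
      (G.cut B).ncard ≤ (G'.cut A).ncard) : G'.IsThreeEdgeConnectedSet S := by
  rintro A ⟨x, hxS, hxA⟩ ⟨y, hyS, hyA⟩
  obtain ⟨B, hB, hBA⟩ := exists_set_mem_iff A hav
  refine le_trans (hS B ⟨x, hxS, ?_⟩ ⟨y, hyS, ?_⟩) (h A B hB hBA)
  · exact (hBA x (by rintro rfl; exact hv hxS)).2 hxA
  · exact fun hy => hyA ((hBA y (by rintro rfl; exact hv hyS)).1 hy)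

/-- A walk that enters v from a has to return to a, so v can be bypassed. The hypothesis on a also
allows v to be isolated or joined to a by parallel edges. -/
lemma exists_isReduction_of_unique_neighbor {G : Graph α β} (hG : G.IsFiniteLoopless)
    {X S : Set α} {v a : α} (hvX : v ∉ X) (hvS : v ∉ S) (hdeg : (G.cut {v}).ncard ≤ 2)
    (hS : G.IsThreeEdgeConnectedSet S) (hav : a ≠ v) (ha : ∀ e y, G.IsLink e v y → y = a) :
    ∃ G', G.IsReduction X S v G' := by
  have hl : ∀ {e x y}, (G.deleteVerts {v}).IsLink e x y ↔ G.IsLink e x y ∧ x ≠ v ∧ y ≠ v := by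
    intro e x y
    simp
  have hle : E(G.deleteVerts {v}) ⊆ E(G) := by
    intro e he
    obtain ⟨x, y, h⟩ := exists_isLink_of_mem_edgeSet he
    exact (hl.1 h).1.edge_mem
  have hV : V(G.deleteVerts {v}) = V(G) \ {v} := by simp
  refine ⟨G.deleteVerts {v}, ⟨⟨fun e x h => hG.loopless.not_isLoopAt e x (hl.1 h).1⟩,
    hV ▸ hG.finite_vertexSet.sdiff, hG.finite_edgeSet.subset hle⟩, hV, fun H => ?_, ?_⟩
  · rw [isThreeCenterCandidate_iff, isThreeCenterCandidate_iff]
    refine and_congr_right fun hH => exists_congr fun πv => ?_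
    constructor
    · rintro ⟨P, hP, hXP, hX⟩
      have hne : ∀ {x}, x ∈ V(H) → πv x ≠ v := fun hx =>
        hP.ne_of_ncard_cut_le hG.finite_edgeSet hH.loopless hX hvX hdeg hx
      refine ⟨P, ⟨fun x hx => hV ▸ ⟨hP.mapsTo hx, hne hx⟩, hP.injOn, fun f x y hf => ?_,
        hP.disjoint⟩, hXP, hX⟩
      have key : ∀ z, G.ReachableIn (P f) (πv x) z →
          (z ≠ v → (G.deleteVerts {v}).ReachableIn (P f) (πv x) z) ∧
          (z = v → (G.deleteVerts {v}).ReachableIn (P f) (πv x) a) := by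
        intro z hz
        induction hz with
        | refl => exact ⟨fun _ => .refl, fun h => absurd h (hne hf.left_mem)⟩
        | @tail b c _ h ih =>
          obtain ⟨e, he, hbc⟩ := h
          by_cases hb : b = v
          · have hc : c = a := ha e c (hb ▸ hbc)
            rw [hc]
            exact ⟨fun _ => ih.2 hb, fun h => absurd h hav⟩
          · refine ⟨fun hc => (ih.1 hb).trans (.of_isLink he (hl.2 ⟨hbc, hb, hc⟩)), fun hc => ?_⟩
            rw [← ha e b (hc ▸ hbc.symm)]
            exact ih.1 hb
      exact (key _ (hP.reachableIn f x y hf)).1 (hne hf.right_mem)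
    · rintro ⟨P, hP, hX⟩
      refine ⟨P, ⟨fun x hx => (hV ▸ hP.mapsTo hx : πv x ∈ V(G) \ {v}).1, hP.injOn,
        fun f x y hf => ?_, hP.disjoint⟩, hX⟩
      exact (hP.reachableIn f x y hf).map (g := id) fun e he x y h => .of_isLink he (hl.1 h).1
  · refine hS.of_ncard_cut_le hvS hav fun A B hB hBA => ?_
    refine Set.ncard_le_ncard ?_
      ((hG.finite_edgeSet.subset hle).subset (cut_subset_edgeSet _ A))
    rintro e ⟨x, y, h, hx, hy⟩
    have hxv : x ≠ v := by
      rintro rfl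
      exact hy (ha e y h ▸ hB.1 hx)
    have hyv : y ≠ v := by
      rintro rfl
      exact hy (hB.2 (ha e x h.symm ▸ hx))
    exact ⟨x, y, hl.2 ⟨h, hxv, hyv⟩, (hBA x hxv).1 hx, fun h => hy ((hBA y hyv).2 h)⟩

/-- Delete the vertex `v` and let the edge `e` join `a` and `b` instead. -/
def splice (G : Graph α β) (v : α) (e : β) (a b : α) (he : G.Inc e v)
    (ha : a ∈ V(G) \ {v}) (hb : b ∈ V(G) \ {v}) : Graph α β where
  vertexSet := V(G) \ {v}
  IsLink f x y := (G.IsLink f x y ∧ x ≠ v ∧ y ≠ v) ∨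
    (f = e ∧ ((x = a ∧ y = b) ∨ (x = b ∧ y = a)))
  isLink_symm := by
    rintro f -
    refine ⟨?_⟩
    rintro x y (⟨h, hx, hy⟩ | ⟨rfl, h | h⟩)
    · exact .inl ⟨h.symm, hy, hx⟩
    · exact .inr ⟨rfl, .inr h.symm⟩
    · exact .inr ⟨rfl, .inl h.symm⟩
  eq_or_eq_of_isLink_of_isLink := by
    rintro f x y z w (⟨h, hx, hy⟩ | ⟨rfl, h⟩) (⟨h', hz, hw⟩ | ⟨h'', h'⟩)
    · exact h.left_eq_or_eq h'
    · subst h''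
      rcases he.eq_or_eq_of_isLink h with h | h
      · exact absurd h.symm hx
      · exact absurd h.symm hy
    · rcases he.eq_or_eq_of_isLink h' with h | h
      · exact absurd h.symm hz
      · exact absurd h.symm hw
    · rcases h with ⟨rfl, rfl⟩ | ⟨rfl, rfl⟩ <;> rcases h' with ⟨rfl, rfl⟩ | ⟨rfl, rfl⟩ <;> simp
  left_mem_of_isLink := by
    rintro f x y (⟨h, hx, hy⟩ | ⟨rfl, ⟨rfl, rfl⟩ | ⟨rfl, rfl⟩⟩)
    · exact ⟨h.left_mem, hx⟩
    · exact ha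
    · exact hb

/-- Here v has exactly the edges e₁ and e₂, so every passage through v from one neighbour to the
other uses both. The spliced edge, still named e₁, represents this passage. -/
lemma exists_isReduction_of_two_neighbors {G : Graph α β} (hG : G.IsFiniteLoopless)
    {X S : Set α} {v a b : α} (hvX : v ∉ X) (hvS : v ∉ S) (hdeg : (G.cut {v}).ncard ≤ 2)
    (hS : G.IsThreeEdgeConnectedSet S) {e₁ e₂ : β} (h₁ : G.IsLink e₁ v a) (h₂ : G.IsLink e₂ v b)
    (hab : a ≠ b) : ∃ G', G.IsReduction X S v G' := by
  have hloop : ∀ {e x y}, G.IsLink e x y → x ≠ y := by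
    rintro e x y h rfl
    exact hG.loopless.not_isLoopAt e x h
  have hav : a ≠ v := (hloop h₁).symm
  have hbv : b ≠ v := (hloop h₂).symm
  have hne : e₁ ≠ e₂ := by
    rintro rfl
    exact hab (h₁.right_unique h₂)
  have hmem : ∀ {e y}, G.IsLink e v y → e ∈ G.cut {v} := fun {e y} h =>
    ⟨v, y, h, rfl, (hloop h).symm⟩
  have hor : ∀ {e y}, G.IsLink e v y → (e = e₁ ∧ y = a) ∨ (e = e₂ ∧ y = b) := by
    intro e y h
    have hpair : ({e₁, e₂} : Set β) = G.cut {v} := by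
      refine Set.eq_of_subset_of_ncard_le ?_ (by rwa [Set.ncard_pair hne]) (hG.finite_cut _)
      rintro _ (rfl | rfl)
      · exact hmem h₁
      · exact hmem h₂
    rcases (hpair ▸ hmem h : e ∈ ({e₁, e₂} : Set β)) with rfl | rfl
    · exact .inl ⟨rfl, h.right_unique h₁⟩
    · exact .inr ⟨rfl, h.right_unique h₂⟩
  set G' := G.splice v e₁ a b h₁.inc_left ⟨h₁.right_mem, hav⟩ ⟨h₂.right_mem, hbv⟩ with hG'
  have hl₀ : ∀ {e x y}, G.IsLink e x y → x ≠ v → y ≠ v → G'.IsLink e x y :=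
    fun h hx hy => .inl ⟨h, hx, hy⟩
  have hl₁ : G'.IsLink e₁ a b := .inr ⟨rfl, .inl ⟨rfl, rfl⟩⟩
  have hnot₂ : ∀ {x y}, ¬ G'.IsLink e₂ x y := by
    rintro x y (⟨h, hx, hy⟩ | ⟨h, -⟩)
    · rcases h₂.left_eq_or_eq h with h | h
      · exact hx h.symm
      · exact hy h.symm
    · exact hne h.symm
  have hle : E(G') ⊆ E(G) := by
    rintro e ⟨x, y, ⟨h, -⟩ | ⟨rfl, -⟩⟩
    · exact h.edge_mem
    · exact h₁.edge_mem
  have hV : V(G') = V(G) \ {v} := rfl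
  refine ⟨G', ⟨⟨?_⟩, hV ▸ hG.finite_vertexSet.sdiff, hG.finite_edgeSet.subset hle⟩, hV,
    fun H => ?_, ?_⟩
  · rintro e x (⟨h, -⟩ | ⟨-, ⟨rfl, h⟩ | ⟨rfl, h⟩⟩)
    · exact hloop h rfl
    · exact hab h
    · exact hab h.symm
  · rw [isThreeCenterCandidate_iff, isThreeCenterCandidate_iff]
    refine and_congr_right fun hH => exists_congr fun πv => ?_
    constructor
    · rintro ⟨P, hP, hXP, hX⟩
      have hπ : ∀ {x}, x ∈ V(H) → πv x ≠ v := fun hx =>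
        hP.ne_of_ncard_cut_le hG.finite_edgeSet hH.loopless hX hvX hdeg hx
      refine ⟨fun f => {e | e ∈ P f ∧ (e = e₁ → e₂ ∈ P f)}, ⟨fun x hx => ⟨hP.mapsTo hx, hπ hx⟩,
        hP.injOn, fun f x y hf => ?_, fun f hf f' hf' e he he' =>
        hP.disjoint f hf f' hf' e he.1 he'.1⟩, hXP, hX⟩
      set Q : Set β := {e | e ∈ P f ∧ (e = e₁ → e₂ ∈ P f)}
      -- While the walk stands at v, the invariant records the edge by which it came and a neighbour
      -- already reached in `G'`; leaving by the other edge is then simulated by the spliced edge.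
      have key : ∀ z, G.ReachableIn (P f) (πv x) z →
          (z ≠ v → G'.ReachableIn Q (πv x) z) ∧
          (z = v → (e₁ ∈ P f ∧ G'.ReachableIn Q (πv x) a) ∨
            (e₂ ∈ P f ∧ G'.ReachableIn Q (πv x) b)) := by
        intro z hz
        induction hz with
        | refl => exact ⟨fun _ => .refl, fun h => absurd h (hπ hf.left_mem)⟩
        | @tail c d _ h ih =>
          obtain ⟨e, he, hcd⟩ := h
          by_cases hc : c = v
          · subst hc
            refine ⟨fun _ => ?_, fun h => absurd h.symm (hloop hcd)⟩
            rcases hor hcd with ⟨rfl, rfl⟩ | ⟨rfl, rfl⟩ <;>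
              rcases ih.2 rfl with ⟨hP', hr⟩ | ⟨hP', hr⟩
            · exact hr
            · exact hr.trans (ReachableIn.of_isLink (P := Q) (e := e) ⟨he, fun _ => hP'⟩ hl₁).symm
            · exact hr.trans (ReachableIn.of_isLink (e := e₁) ⟨hP', fun _ => he⟩ hl₁)
            · exact hr
          · refine ⟨fun hd => ?_, ?_⟩
            · refine (ih.1 hc).trans (ReachableIn.of_isLink (e := e) ⟨he, ?_⟩ (hl₀ hcd hc hd))
              rintro rfl
              rcases h₁.left_eq_or_eq hcd with h | h
              · exact absurd h.symm hc
              · exact absurd h.symm hd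
            · rintro rfl
              rcases hor hcd.symm with ⟨rfl, rfl⟩ | ⟨rfl, rfl⟩
              · exact .inl ⟨he, ih.1 hc⟩
              · exact .inr ⟨he, ih.1 hc⟩
      exact (key _ (hP.reachableIn f x y hf)).1 (hπ hf.right_mem)
    · rintro ⟨P, hP, hX⟩
      -- The owner of e₁ also receives e₂. As e₂ is not an edge of `G'`, it may occur in `P f` as a
      -- superfluous element and must be removed from any other set.
      refine ⟨fun f => {e | (e ∈ P f ∧ e ≠ e₂) ∨ (e = e₂ ∧ e₁ ∈ P f)},
        ⟨fun x hx => (hP.mapsTo hx).1, hP.injOn, fun f x y hf => ?_, ?_⟩, hX⟩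
      · refine (hP.reachableIn f x y hf).map (g := id) fun e he x y h => ?_
        have hne₂ : e ≠ e₂ := by
          rintro rfl
          exact hnot₂ h
        rcases h with ⟨h, -⟩ | ⟨rfl, h⟩
        · exact .of_isLink (.inl ⟨he, hne₂⟩) h
        · have hr : G.ReachableIn {e' | (e' ∈ P f ∧ e' ≠ e₂) ∨ (e' = e₂ ∧ e ∈ P f)} a b :=
            (ReachableIn.of_isLink (e := e) (.inl ⟨he, hne₂⟩) h₁.symm).trans
              (.of_isLink (e := e₂) (.inr ⟨rfl, he⟩) h₂)
          rcases h with ⟨rfl, rfl⟩ | ⟨rfl, rfl⟩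
          · exact hr
          · exact hr.symm
      · rintro f hf f' hf' e (⟨he, h⟩ | ⟨rfl, he⟩) (⟨he', h'⟩ | ⟨h', he'⟩)
        · exact hP.disjoint f hf f' hf' e he he'
        · exact absurd h' h
        · exact absurd rfl h'
        · exact hP.disjoint f hf f' hf' e₁ he he'
  · refine hS.of_ncard_cut_le hvS hav fun A B hB hBA => ?_
    classical
    -- Since v is on the side of a, the name e₁ is unused in this cut, so renaming e₂ to e₁ is
    -- injective on it.
    have h₁B : e₁ ∉ G.cut B := by
      rintro ⟨x, y, h, hx, hy⟩
      rcases h₁.eq_and_eq_or_eq_and_eq h with ⟨rfl, rfl⟩ | ⟨rfl, rfl⟩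
      · exact hy (hB.1 hx)
      · exact hy (hB.2 hx)
    refine Set.ncard_le_ncard_of_injOn (fun e => if e = e₂ then e₁ else e) ?_ ?_
      ((hG.finite_edgeSet.subset hle).subset (cut_subset_edgeSet _ A))
    · rintro e ⟨x, y, h, hx, hy⟩
      by_cases he : e = e₂
      · subst he
        simp only [if_true]
        rcases h₂.eq_and_eq_or_eq_and_eq h with ⟨rfl, rfl⟩ | ⟨rfl, rfl⟩
        · exact ⟨a, b, hl₁, (hBA a hav).1 (hB.1 hx), fun h => hy ((hBA b hbv).2 h)⟩
        · exact ⟨b, a, hl₁.symm, (hBA b hbv).1 hx, fun h => hy (hB.2 ((hBA a hav).2 h))⟩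
      · simp only [he, if_false]
        have hxv : x ≠ v := by
          rintro rfl
          rcases hor h with ⟨rfl, rfl⟩ | ⟨rfl, -⟩
          · exact hy (hB.1 hx)
          · exact he rfl
        have hyv : y ≠ v := by
          rintro rfl
          rcases hor h.symm with ⟨rfl, rfl⟩ | ⟨rfl, -⟩
          · exact hy (hB.2 hx)
          · exact he rfl
        exact ⟨x, y, hl₀ h hxv hyv, (hBA x hxv).1 hx, fun h => hy ((hBA y hyv).2 h)⟩
    · intro e he e' he' heq
      simp only at heq
      split_ifs at heq with h h' h'
      · exact h.trans h'.symm
      · exact absurd (heq ▸ he') h₁B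
      · exact absurd (heq ▸ he) h₁B
      · exact heq

/-- The 3-center exists, and contains all vertices of a 3-edge-connected set. -/
lemma exists_isThreeCenter {S : Set α} (hS₂ : S.Nontrivial) {X : Set α} (n : ℕ) :
    ∀ {G : Graph α β}, V(G).ncard = n → G.IsFiniteLoopless → X ⊆ V(G) → S ⊆ V(G) →
      G.IsThreeEdgeConnectedSet S →
      ∃ H : Graph ℕ ℕ, G.IsThreeCenter X H ∧ S.ncard ≤ V(H).ncard := by
  induction n with
  | zero =>
    intro G hn hG _ hSV
    obtain ⟨x, hx⟩ := hS₂.nonempty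
    rw [Set.ncard_eq_zero hG.finite_vertexSet] at hn
    exact absurd (hSV hx) (by simp [hn])
  | succ n ih =>
    intro G hn hG hXV hSV hS
    have : Nonempty α := ⟨hS₂.nonempty.choose⟩
    by_cases hdeg : ∀ v ∈ V(G), v ∉ X → 3 ≤ (G.cut {v}).ncard
    · obtain ⟨H, hH, hcard⟩ := exists_isThreeCenter_of_three_le hG hXV hdeg
      exact ⟨H, hH, hcard ▸ Set.ncard_le_ncard hSV hG.finite_vertexSet⟩
    push Not at hdeg
    obtain ⟨v, hv, hvX, hlt⟩ := hdeg
    have hvS : v ∉ S := by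
      intro hvS
      obtain ⟨w, hw, hwv⟩ := hS₂.exists_ne v
      exact absurd (hS {v} ⟨v, hvS, rfl⟩ ⟨w, hw, hwv⟩) (by omega)
    have hred : ∃ G', G.IsReduction X S v G' := by
      by_cases hu : ∃ a, a ≠ v ∧ ∀ e y, G.IsLink e v y → y = a
      · obtain ⟨a, hav, ha⟩ := hu
        exact exists_isReduction_of_unique_neighbor hG hvX hvS (by omega) hS hav ha
      · push Not at hu
        -- Any vertex other than v contradicts `hu` unless v has a neighbour; applying `hu` to that
        -- neighbour yields a second one.
        obtain ⟨w, -, hwv⟩ := hS₂.exists_ne v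
        obtain ⟨e₁, a, h₁, -⟩ := hu w hwv
        have hav : a ≠ v := by
          rintro rfl
          exact hG.loopless.not_isLoopAt _ _ h₁
        obtain ⟨e₂, b, h₂, hba⟩ := hu a hav
        exact exists_isReduction_of_two_neighbors hG hvX hvS (by omega) hS h₁ h₂ hba.symm
    obtain ⟨G', hG'⟩ := hred
    have hsub : ∀ {Y : Set α}, Y ⊆ V(G) → v ∉ Y → Y ⊆ V(G') := fun hY hvY x hx =>
      hG'.vertexSet ▸ ⟨hY hx, by rintro rfl; exact hvY hx⟩
    obtain ⟨H, hH, hcard⟩ := ih (G := G') (by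
      rw [hG'.vertexSet, Set.ncard_sdiff_singleton_of_mem hv, hn]; rfl) hG'.finiteLoopless
      (hsub hXV hvX) (hsub hSV hvS) hG'.connectedSet
    exact ⟨H, hG'.isThreeCenter hH, hcard⟩

/-- The order is an `sSup` in ℕ, so both existence of a 3-center and a bound are needed; the bound
is that branch vertices inject into `V(G)`. -/
lemma ncard_le_threeCenterOrder {G : Graph α β} (hG : G.IsFiniteLoopless) {X S : Set α}
    (hX : X ⊆ V(G)) (hSV : S ⊆ V(G)) (hS₂ : S.Nontrivial) (hS : G.IsThreeEdgeConnectedSet S) :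
    S.ncard ≤ G.threeCenterOrder X := by
  obtain ⟨H, hH, hcard⟩ := exists_isThreeCenter hS₂ _ rfl hG hX hSV hS
  refine hcard.trans (le_csSup ⟨V(G).ncard, ?_⟩ ⟨H, hH, rfl⟩)
  rintro _ ⟨K, ⟨⟨-, πv, πe, hπ, -⟩, -⟩, rfl⟩
  exact Set.ncard_le_ncard_of_injOn πv (fun x hx => hπ.mapsTo hx) hπ.injOn hG.finite_vertexSet

end ThreeCenter

/-! ### Cuts of the wall -/

section WallCut

/-- `K` contains, with vertices renamed to pairs of natural numbers, all edges of the wall `H_N`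
whose endpoints are distinguished by `f`. -/
structure IsWallCut (N : ℕ) (f : ℕ → ℕ → Prop) (K : Set (Sym2 (ℕ × ℕ))) : Prop where
  finite : K.Finite
  horizontal : ∀ i j, i < N → j + 1 < N → ¬ (f i j ↔ f i (j + 1)) → s((i, j), (i, j + 1)) ∈ K
  vertical : ∀ i j, i + 1 < N → j < N → i % 2 = j % 2 → ¬ (f i j ↔ f (i + 1) j) →
    s((i, j), (i + 1, j)) ∈ K

/-- Some edge in `K` joins two vertices of `Z`. -/
def MeetsEdges (K : Set (Sym2 (ℕ × ℕ))) (Z : Set (ℕ × ℕ)) : Prop :=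
  ∃ p q, p ≠ q ∧ p ∈ Z ∧ q ∈ Z ∧ s(p, q) ∈ K

lemma MeetsEdges.mono {K : Set (Sym2 (ℕ × ℕ))} {Z Z' : Set (ℕ × ℕ)} (h : MeetsEdges K Z)
    (hZ : Z ⊆ Z') : MeetsEdges K Z' := by
  obtain ⟨p, q, hne, hp, hq, hK⟩ := h
  exact ⟨p, q, hne, hZ hp, hZ hq, hK⟩

/-- Sets with at most one common vertex span no common edge, so the chosen edges of K are distinct.
Edge-disjoint paths are thus handled through their vertex sets. -/
lemma card_le_ncard_of_meetsEdges {ι : Type*} {K : Set (Sym2 (ℕ × ℕ))} (hK : K.Finite)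
    (I : Finset ι) (Z : ι → Set (ℕ × ℕ)) (hZ : ∀ i ∈ I, MeetsEdges K (Z i))
    (hdisj : ∀ i ∈ I, ∀ j ∈ I, i ≠ j → (Z i ∩ Z j).Subsingleton) : I.card ≤ K.ncard := by
  choose! p q hne hp hq hpq using hZ
  rw [← Set.ncard_coe_finset]
  refine Set.ncard_le_ncard_of_injOn (fun i => s(p i, q i)) hpq ?_ hK
  intro i hi j hj hij
  by_contra hn
  have hs : p i ∈ Z j ∧ q i ∈ Z j := by
    rcases Sym2.eq_iff.1 hij with ⟨h₁, h₂⟩ | ⟨h₁, h₂⟩ <;> rw [h₁, h₂]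
    · exact ⟨hp j hj, hq j hj⟩
    · exact ⟨hq j hj, hp j hj⟩
  exact hne i hi (hdisj i hi j hj hn ⟨hp i hi, hs.1⟩ ⟨hq i hi, hs.2⟩)

lemma three_le_ncard_of_meetsEdges {K : Set (Sym2 (ℕ × ℕ))} (hK : K.Finite)
    {Z₁ Z₂ Z₃ : Set (ℕ × ℕ)} (h₁ : MeetsEdges K Z₁) (h₂ : MeetsEdges K Z₂)
    (h₃ : MeetsEdges K Z₃) (h₁₂ : (Z₁ ∩ Z₂).Subsingleton) (h₁₃ : (Z₁ ∩ Z₃).Subsingleton)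
    (h₂₃ : (Z₂ ∩ Z₃).Subsingleton) : 3 ≤ K.ncard := by
  have h := card_le_ncard_of_meetsEdges hK (Finset.univ : Finset (Fin 3)) ![Z₁, Z₂, Z₃]
    (by simp [Fin.forall_fin_succ, h₁, h₂, h₃])
    (by simp [Fin.forall_fin_succ, h₁₂, h₁₃, h₂₃, Set.inter_comm Z₂ Z₁, Set.inter_comm Z₃ Z₁,
      Set.inter_comm Z₃ Z₂])
  simpa using h

namespace IsWallCut

variable {N : ℕ} {f : ℕ → ℕ → Prop} {K : Set (Sym2 (ℕ × ℕ))}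

lemma meetsEdges_row (h : IsWallCut N f K) {i a b : ℕ} (hi : i < N) (hab : a ≤ b) (hb : b < N)
    (hf : ¬ (f i a ↔ f i b)) : MeetsEdges K {p | p.1 = i ∧ a ≤ p.2 ∧ p.2 ≤ b} := by
  by_contra hn
  refine hf ?_
  have key : ∀ j, a ≤ j → j ≤ b → (f i a ↔ f i j) := by
    intro j hj
    induction j, hj using Nat.le_induction with
    | base => simp
    | succ j hj ih =>
      intro hjb
      rw [ih (by omega)]
      by_contra hc
      exact hn ⟨_, _, by simp, ⟨rfl, hj, by simp only; omega⟩, ⟨rfl, by simp only; omega, hjb⟩,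
        h.horizontal i j hi (by omega) hc⟩
  exact key b hab le_rfl

/-- Columns 2k and 2k + 1 carry a path through all rows: it descends in column 2k from even rows and
in column 2k + 1 from odd rows, crossing horizontally in between. -/
lemma meetsEdges_zigzag (h : IsWallCut N f K) {k a b : ℕ} (hk : 2 * k + 1 < N) (hab : a ≤ b)
    (hb : b < N) {j j' : ℕ} (hj : j = 2 * k ∨ j = 2 * k + 1) (hj' : j' = 2 * k ∨ j' = 2 * k + 1)
    (hf : ¬ (f a j ↔ f b j')) :
    MeetsEdges K {p | a ≤ p.1 ∧ p.1 ≤ b ∧ (p.2 = 2 * k ∨ p.2 = 2 * k + 1)} := by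
  by_contra hn
  refine hf ?_
  have hrow : ∀ i, a ≤ i → i ≤ b → (f i (2 * k) ↔ f i (2 * k + 1)) := by
    intro i hai hib
    by_contra hc
    exact hn ⟨_, _, by simp, ⟨hai, hib, .inl rfl⟩, ⟨hai, hib, .inr rfl⟩,
      h.horizontal i (2 * k) (by omega) (by omega) hc⟩
  have hcol : ∀ i l, a ≤ i → i + 1 ≤ b → i % 2 = l % 2 → (l = 2 * k ∨ l = 2 * k + 1) →
      (f i l ↔ f (i + 1) l) := by
    intro i l hai hib hil hl
    by_contra hc
    exact hn ⟨_, _, by simp, ⟨hai, by simp only; omega, hl⟩, ⟨by simp only; omega, hib, hl⟩,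
      h.vertical i l (by omega) (by omega) hil hc⟩
  have key : ∀ i, a ≤ i → i ≤ b → (f a (2 * k) ↔ f i (2 * k)) := by
    intro i hi
    induction i, hi using Nat.le_induction with
    | base => simp
    | succ i hi ih =>
      intro hib
      rw [ih (by omega)]
      rcases Nat.mod_two_eq_zero_or_one i with h0 | h1
      · exact hcol i _ hi hib (by omega) (.inl rfl)
      · rw [hrow i hi (by omega), hrow (i + 1) (by omega) hib]
        exact hcol i _ hi hib (by omega) (.inr rfl)
  have ha : f a j ↔ f a (2 * k) := by
    rcases hj with rfl | rfl
    · rfl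
    · exact (hrow a le_rfl hab).symm
  have hb' : f b j' ↔ f b (2 * k) := by
    rcases hj' with rfl | rfl
    · rfl
    · exact (hrow b hab le_rfl).symm
  rw [ha, hb']
  exact key b hab le_rfl

lemma exists_uncut_row (h : IsWallCut N f K) {I : Finset ℕ} (hI : ∀ i ∈ I, i < N)
    (hcard : K.ncard < I.card) : ∃ i ∈ I, ∀ j < N, f i 0 ↔ f i j := by
  by_contra! hn
  refine hcard.not_ge (card_le_ncard_of_meetsEdges h.finite I (fun i => {p | p.1 = i})
    (fun i hi => ?_) ?_)
  · obtain ⟨j, hj, hc⟩ := hn i hi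
    exact (h.meetsEdges_row (hI i hi) (Nat.zero_le j) hj (by tauto)).mono fun p hp => hp.1
  · rintro i - j - hij p ⟨hp, hp'⟩
    exact absurd (hp.symm.trans hp') hij

lemma exists_uncut_zigzag {M : ℕ} (h : IsWallCut (2 * M) f K) (hcard : K.ncard < M) :
    ∃ k < M, ∀ i < 2 * M, f 0 (2 * k) ↔ f i (2 * k) := by
  by_contra! hn
  refine hcard.not_ge ?_
  rw [← Finset.card_range M]
  refine card_le_ncard_of_meetsEdges h.finite _
    (fun k => {p | p.2 = 2 * k ∨ p.2 = 2 * k + 1}) (fun k hk => ?_) ?_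
  · have hk := Finset.mem_range.1 hk
    obtain ⟨i, hi, hc⟩ := hn k hk
    exact (h.meetsEdges_zigzag (by omega) (Nat.zero_le i) hi (.inl rfl) (.inl rfl)
      (by tauto)).mono fun p hp => hp.2.2
  · rintro k - l - hkl p ⟨hp, hp'⟩
    simp only [Set.mem_ofPred_eq] at hp hp'
    omega

/-- All rows not met by a small cut lie on the same side of it. -/
lemma exists_side {M : ℕ} (h : IsWallCut (2 * M) f K) (hcard : K.ncard < M) :
    ∃ b : Prop, ∀ i < 2 * M, (∀ j < 2 * M, f i 0 ↔ f i j) → ∀ j < 2 * M, f i j ↔ b := by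
  obtain ⟨k, hk, hf⟩ := h.exists_uncut_zigzag hcard
  refine ⟨f 0 (2 * k), fun i hi hrow j hj => ?_⟩
  rw [← hrow j hj, hrow (2 * k) (by omega), hf i hi]

lemma card_le_of_side {M : ℕ} (h : IsWallCut (2 * M) f K) {b : Prop}
    (hb : ∀ i < 2 * M, (∀ j < 2 * M, f i 0 ↔ f i j) → ∀ j < 2 * M, f i j ↔ b)
    (I : Finset (Fin (M - 2)))
    (hI : ∀ k ∈ I, ¬ (f (2 * k + 3) (2 * k + 2) ↔ b)) : I.card ≤ K.ncard := by
  refine card_le_ncard_of_meetsEdges h.finite I (fun k => {p | p.1 = 2 * k + 3})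
    (fun k hk => ?_) ?_
  · have hkM := k.2
    have hrow : ∃ j < 2 * M, ¬ (f (2 * k + 3) 0 ↔ f (2 * k + 3) j) := by
      by_contra! hc
      exact hI k hk (hb _ (by omega) hc _ (by omega))
    obtain ⟨j, hj, hc⟩ := hrow
    exact (h.meetsEdges_row (by omega) (Nat.zero_le j) hj hc).mono fun p hp => hp.1
  · rintro k - l - hkl p ⟨hp, hp'⟩
    simp only [Set.mem_ofPred_eq] at hp hp'
    exact absurd (Fin.ext (by omega)) hkl

/-- From the diagonal vertex, go left or right along its row and then along the first or last zigzag
to an uncut row, or go up through its own zigzag to an uncut row above it. These routes share only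
the diagonal vertex, and each must be cut. The offsets in (2k + 3, 2k + 2) make this work: at least
three rows lie above, the vertical edge upwards exists, and the three zigzags are disjoint. -/
lemma three_le_of_side {M : ℕ} (h : IsWallCut (2 * M) f K) (hM : 3 ≤ M) {b : Prop}
    (hb : ∀ i < 2 * M, (∀ j < 2 * M, f i 0 ↔ f i j) → ∀ j < 2 * M, f i j ↔ b)
    (k : Fin (M - 2)) (hk : ¬ (f (2 * k + 3) (2 * k + 2) ↔ b)) : 3 ≤ K.ncard := by
  by_contra! hlt
  have hkM := k.2
  obtain ⟨i₀, hi₀, hrow₀⟩ := h.exists_uncut_row (I := Finset.range (2 * M))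
    (fun i hi => Finset.mem_range.1 hi) (by rw [Finset.card_range]; omega)
  rw [Finset.mem_range] at hi₀
  obtain ⟨i₁, hi₁, hrow₁⟩ := h.exists_uncut_row (I := Finset.range (2 * k + 3))
    (fun i hi => by have := Finset.mem_range.1 hi; omega) (by rw [Finset.card_range]; omega)
  rw [Finset.mem_range] at hi₁
  have hf₀ := hb i₀ hi₀ hrow₀
  have hf₁ := hb i₁ (by omega) hrow₁
  -- a zigzag path at the end of the row meets the uncut row
  have hside : ∀ l < M, ∀ j, (j = 2 * l ∨ j = 2 * l + 1) → ¬ (f (2 * k + 3) j ↔ b) →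
      MeetsEdges K {p | p.2 = 2 * l ∨ p.2 = 2 * l + 1} := by
    intro l hl j hj hc
    rcases le_total i₀ (2 * k + 3) with hle | hle
    · refine (h.meetsEdges_zigzag (by omega) hle (by omega) hj hj ?_).mono fun p hp => hp.2.2
      have := hf₀ j (by omega)
      tauto
    · refine (h.meetsEdges_zigzag (by omega) hle (by omega) hj hj ?_).mono fun p hp => hp.2.2
      have := hf₀ j (by omega)
      tauto
  have hleft : MeetsEdges K {p | (p.1 = 2 * k + 3 ∧ p.2 ≤ 2 * k + 2) ∨ p.2 = 0 ∨ p.2 = 1} := by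
    by_cases hc : f (2 * k + 3) 0 ↔ f (2 * k + 3) (2 * k + 2)
    · refine (hside 0 (by omega) 0 (by omega) (by tauto)).mono fun p hp => .inr ?_
      simpa using hp
    · exact (h.meetsEdges_row (by omega) (by omega) (by omega) hc).mono
        fun p hp => .inl ⟨hp.1, hp.2.2⟩
  have hright : MeetsEdges K {p | (p.1 = 2 * k + 3 ∧ 2 * k + 2 ≤ p.2) ∨ p.2 = 2 * (M - 1) ∨
      p.2 = 2 * (M - 1) + 1} := by
    by_cases hc : f (2 * k + 3) (2 * k + 2) ↔ f (2 * k + 3) (2 * (M - 1))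
    · exact (hside (M - 1) (by omega) (2 * (M - 1)) (.inl rfl) (by tauto)).mono
        fun p hp => .inr hp
    · exact (h.meetsEdges_row (by omega) (by omega) (by omega) hc).mono
        fun p hp => .inl ⟨hp.1, hp.2.1⟩
  have hup : MeetsEdges K {p | p = (2 * k.val + 3, 2 * k.val + 2) ∨
      (p.1 ≤ 2 * k + 2 ∧ (p.2 = 2 * k + 2 ∨ p.2 = 2 * k + 3))} := by
    by_cases hc : f (2 * k + 2) (2 * k + 2) ↔ f (2 * k + 3) (2 * k + 2)
    · refine (h.meetsEdges_zigzag (k := k + 1) (a := i₁) (b := 2 * k + 2) (j := 2 * k + 2)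
        (j' := 2 * k + 2) (by omega) (by omega) (by omega) (.inl rfl) (.inl rfl) ?_).mono
        fun p hp => .inr ⟨hp.2.1, hp.2.2⟩
      have := hf₁ (2 * k + 2) (by omega)
      tauto
    · exact ⟨_, _, by simp, .inr ⟨le_rfl, .inl rfl⟩, .inl rfl,
        h.vertical (2 * k + 2) (2 * k + 2) (by omega) (by omega) rfl hc⟩
  have hsub : ∀ Z : Set (ℕ × ℕ), (∀ p ∈ Z, p.1 = 2 * k.val + 3 ∧ p.2 = 2 * k.val + 2) →
      Z.Subsingleton := fun Z hZ p hp q hq =>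
    Prod.ext ((hZ p hp).1.trans (hZ q hq).1.symm) ((hZ p hp).2.trans (hZ q hq).2.symm)
  refine hlt.not_ge (three_le_ncard_of_meetsEdges h.finite hleft hright hup
    (hsub _ ?_) (hsub _ ?_) (hsub _ ?_))
  all_goals
    rintro ⟨p₁, p₂⟩ ⟨hp, hp'⟩
    simp only [Set.mem_ofPred_eq, Prod.mk.injEq] at hp hp' ⊢
    omega

end IsWallCut

/-- The vertex of `H_{2M}` on the intersection of the row with index `2k + 3` and the column with
index `2k + 2` (counted from zero). -/
def wallDiagonal (M : ℕ) (k : Fin (M - 2)) : Fin (2 * M) × Fin (2 * M) :=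
  (⟨2 * k + 3, by omega⟩, ⟨2 * k + 2, by omega⟩)

lemma wallDiagonal_mem (M : ℕ) (k : Fin (M - 2)) : wallDiagonal M k ∈ V(wall (2 * M)) :=
  Set.mem_univ _

lemma wallDiagonal_injective (M : ℕ) : Function.Injective (wallDiagonal M) := by
  intro k l h
  have := congrArg (fun p => p.1.val) h
  simp only [wallDiagonal] at this
  exact Fin.ext (by omega)

/-- Natural-number coordinates keep the index arithmetic free of `Fin`. -/
lemma exists_isWallCut {N : ℕ} (A : Set (Fin N × Fin N)) :
    ∃ (f : ℕ → ℕ → Prop) (K : Set (Sym2 (ℕ × ℕ))), IsWallCut N f K ∧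
      K.ncard ≤ ((wall N).cut A).ncard ∧ ∀ p : Fin N × Fin N, f p.1 p.2 ↔ p ∈ A := by
  let f : ℕ → ℕ → Prop := fun i j => ∃ (hi : i < N) (hj : j < N), (⟨i, hi⟩, ⟨j, hj⟩) ∈ A
  have hf : ∀ p : Fin N × Fin N, f p.1 p.2 ↔ p ∈ A := fun p =>
    ⟨fun ⟨_, _, h⟩ => h, fun h => ⟨p.1.2, p.2.2, h⟩⟩
  have hfin : ((wall N).cut A).Finite := Set.toFinite _
  let g : Fin N × Fin N → ℕ × ℕ := fun p => (p.1, p.2)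
  have key : ∀ p q, (wallSimpleGraph N).Adj p q → ¬ (f p.1 p.2 ↔ f q.1 q.2) →
      s(g p, g q) ∈ Sym2.map g '' (wall N).cut A := by
    intro p q hpq hne
    rw [hf, hf] at hne
    refine ⟨s(p, q), ?_, rfl⟩
    have hl : (wall N).IsLink s(p, q) p q := ⟨rfl, hpq⟩
    by_cases hp : p ∈ A
    · exact ⟨p, q, hl, hp, by tauto⟩
    · exact ⟨q, p, hl.symm, by tauto, hp⟩
  refine ⟨f, Sym2.map g '' (wall N).cut A, ⟨hfin.image _, ?_, ?_⟩, Set.ncard_image_le hfin, hf⟩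
  · intro i j hi hj hne
    refine key (⟨i, hi⟩, ⟨j, by omega⟩) (⟨i, hi⟩, ⟨j + 1, hj⟩) ?_ hne
    simp [wallSimpleGraph]
  · intro i j hi hj hij hne
    refine key (⟨i, by omega⟩, ⟨j, hj⟩) (⟨i + 1, hi⟩, ⟨j, hj⟩) ?_ hne
    simp only [wallSimpleGraph, SimpleGraph.fromRel_adj]
    refine ⟨by simp, .inl (.inr ⟨trivial, trivial, ?_⟩)⟩
    simp only [Nat.odd_iff, Nat.even_iff]
    omega

/-- Every small cut of the wall has a side containing almost all of the diagonal vertices, and all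
of them if the cut has at most two edges. -/
lemma exists_wall_side {M : ℕ} (hM : 3 ≤ M) (A : Set (Fin (2 * M) × Fin (2 * M)))
    (hA : ((wall (2 * M)).cut A).ncard < M) :
    ∃ b : Prop, (∀ I : Finset (Fin (M - 2)), (∀ k ∈ I, ¬ (wallDiagonal M k ∈ A ↔ b)) →
        I.card ≤ ((wall (2 * M)).cut A).ncard) ∧
      ∀ k, ¬ (wallDiagonal M k ∈ A ↔ b) → 3 ≤ ((wall (2 * M)).cut A).ncard := by
  obtain ⟨f, K, hK, hcard, hf⟩ := exists_isWallCut A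
  obtain ⟨b, hb⟩ := hK.exists_side (hcard.trans_lt hA)
  refine ⟨b, fun I hI => (hK.card_le_of_side hb I fun k hk => ?_).trans hcard,
    fun k hk => (hK.three_le_of_side hM hb k ?_).trans hcard⟩
  · exact fun h => hI k hk ((hf (wallDiagonal M k)).symm.trans h)
  · exact fun h => hk ((hf (wallDiagonal M k)).symm.trans h)

lemma three_le_ncard_wall_cut {M : ℕ} (hM : 3 ≤ M) {A : Set (Fin (2 * M) × Fin (2 * M))}
    {k l : Fin (M - 2)} (hk : wallDiagonal M k ∈ A) (hl : wallDiagonal M l ∉ A) :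
    3 ≤ ((wall (2 * M)).cut A).ncard := by
  by_contra! hlt
  obtain ⟨b, -, hb⟩ := exists_wall_side hM A (by omega)
  have hk' : wallDiagonal M k ∈ A ↔ b := by
    by_contra hc
    exact hlt.not_ge (hb k hc)
  have hl' : wallDiagonal M l ∈ A ↔ b := by
    by_contra hc
    exact hlt.not_ge (hb l hc)
  exact hl (hl'.2 (hk'.1 hk))

open Classical in
lemma wall_cut_dichotomy {M : ℕ} (hM : 3 ≤ M) (A : Set (Fin (2 * M) × Fin (2 * M))) {c : ℕ}
    (hA : ((wall (2 * M)).cut A).ncard ≤ c) (hc : c < M) :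
    (Finset.univ.filter fun k => wallDiagonal M k ∈ A).card ≤ c ∨
      (Finset.univ.filter fun k => wallDiagonal M k ∉ A).card ≤ c := by
  obtain ⟨b, hb, -⟩ := exists_wall_side hM A (by omega)
  by_cases hbt : b
  · refine .inr ((hb _ fun k hk => ?_).trans hA)
    simp only [Finset.mem_filter] at hk
    tauto
  · refine .inl ((hb _ fun k hk => ?_).trans hA)
    simp only [Finset.mem_filter] at hk
    tauto

end WallCut

/-! ### Sides of tree edges, and sinks of orientations -/

section Tree

variable {τ : Type*} {T : SimpleGraph τ}

/-- For an edge `uv` of the tree `T`, the component of `T - uv` that contains `v`. -/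
def treeSide (T : SimpleGraph τ) (u v : τ) : Set τ :=
  {t | (T.deleteEdges {s(u, v)}).Reachable v t}

lemma disjoint_treeSide (hT : T.IsTree) {u v : τ} (huv : T.Adj u v) :
    Disjoint (treeSide T u v) (treeSide T v u) := by
  rw [Set.disjoint_left]
  intro t ht ht'
  have hb := SimpleGraph.isAcyclic_iff_forall_adj_isBridge.1 hT.isAcyclic huv
  rw [SimpleGraph.isBridge_iff] at hb
  rw [treeSide, Sym2.eq_swap] at ht'
  exact hb (ht'.trans ht.symm)

lemma self_mem_treeSide (u v : τ) : v ∈ treeSide T u v :=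
  SimpleGraph.Reachable.refl _

lemma treeSide_ssubset (hT : T.IsTree) {u v w : τ} (huv : T.Adj u v) (hvw : T.Adj v w)
    (hwu : w ≠ u) : treeSide T v w ⊂ treeSide T u v := by
  have hv : v ∉ treeSide T v w := fun h =>
    Set.disjoint_left.1 (disjoint_treeSide hT hvw) h (self_mem_treeSide w v)
  refine ⟨fun t ht => ?_, fun h => hv (h (self_mem_treeSide u v))⟩
  have key : ∀ t, Relation.ReflTransGen (T.deleteEdges {s(v, w)}).Adj w t →
      (T.deleteEdges {s(u, v)}).Reachable v t := by
    intro t ht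
    induction ht with
    | refl =>
      refine SimpleGraph.Adj.reachable ?_
      rw [SimpleGraph.deleteEdges_adj]
      refine ⟨hvw, fun h => ?_⟩
      rcases Sym2.eq_iff.1 h with ⟨h₁, -⟩ | ⟨-, h₂⟩
      · exact huv.ne h₁.symm
      · exact hwu h₂
    | @tail a b ha hab ih =>
      have hb : b ∈ treeSide T v w :=
        (SimpleGraph.reachable_iff_reflTransGen _ _).2 (ha.tail hab)
      have ha' : a ∈ treeSide T v w := (SimpleGraph.reachable_iff_reflTransGen _ _).2 ha
      refine ih.trans (SimpleGraph.Adj.reachable ?_)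
      rw [SimpleGraph.deleteEdges_adj] at hab ⊢
      refine ⟨hab.1, fun h => ?_⟩
      rcases Sym2.eq_iff.1 h with ⟨-, h₂⟩ | ⟨h₁, -⟩
      · exact hv (h₂ ▸ hb)
      · exact hv (h₁ ▸ ha')
  exact key t ((SimpleGraph.reachable_iff_reflTransGen _ _).1 ht)

/-- An orientation of the edges of a finite tree has a sink. -/
lemma exists_sink [Finite τ] (hT : T.IsTree) (Big : τ → τ → Prop)
    (hBig : ∀ u v, T.Adj u v → Big u v → ¬ Big v u) : ∃ t, ∀ s, T.Adj t s → ¬ Big t s := by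
  by_cases hne : {p : τ × τ | T.Adj p.1 p.2 ∧ Big p.1 p.2}.Nonempty
  -- Take an oriented edge whose head side is smallest: an edge leaving its head v would either
  -- reverse it or have a strictly smaller side.
  · obtain ⟨⟨u, v⟩, ⟨huv, hb⟩, hmin⟩ := Set.exists_min_image _
      (fun p : τ × τ => (treeSide T p.1 p.2).ncard) (Set.toFinite _) hne
    refine ⟨v, fun w hvw hbw => ?_⟩
    by_cases hwu : w = u
    · exact hBig u v huv hb (hwu ▸ hbw)
    · exact (hmin (v, w) ⟨hvw, hbw⟩).not_gt
        (Set.ncard_lt_ncard (treeSide_ssubset hT huv hvw hwu) (Set.toFinite _))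
  · obtain ⟨t⟩ := hT.connected.nonempty
    exact ⟨t, fun s hts hb => hne ⟨(t, s), hts, hb⟩⟩

/-- Each component of `T - t` lies in the component of `T - ts` avoiding `t`, for some `s`. -/
lemma exists_component_subset_treeSide (hT : T.IsTree) (t : τ)
    (C : (T.induce {t}ᶜ).ConnectedComponent) :
    ∃ s, T.Adj t s ∧ ∀ y (hy : y ≠ t),
      (T.induce {t}ᶜ).connectedComponentMk ⟨y, hy⟩ = C → y ∈ treeSide T t s := by
  obtain ⟨⟨y₀, hy₀⟩, rfl⟩ := C.exists_rep
  obtain ⟨p, hp⟩ := (hT.connected t y₀).exists_isPath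
  cases p with
  | nil => exact absurd rfl hy₀
  | @cons _ s _ hts q =>
    rw [SimpleGraph.Walk.cons_isPath_iff] at hp
    have hq : ∀ x ∈ q.support, x ∈ ({t}ᶜ : Set τ) := by
      rintro x hx rfl
      exact hp.2 hx
    refine ⟨s, hts, fun y hy hyC => ?_⟩
    have hr := (q.induce _ hq).reachable.trans (SimpleGraph.ConnectedComponent.exact hyC).symm
    let g : T.induce {t}ᶜ →g T.deleteEdges {s(t, s)} :=
      { toFun := Subtype.val
        map_rel' := by
          rintro ⟨a, ha⟩ ⟨b, hb⟩ hab
          rw [SimpleGraph.deleteEdges_adj]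
          refine ⟨hab, fun h => ?_⟩
          rcases Sym2.eq_iff.1 h with ⟨h₁, -⟩ | ⟨-, h₂⟩
          · exact ha h₁
          · exact hb h₂ }
    exact hr.map g

end Tree

/-! ### Consolidation and its cuts -/

section Consolidate

variable {α β γ : Type*} {G : Graph α β}

lemma consolidate_isLink {f : α → γ} {e : β} {x y : γ} :
    (consolidate f G).IsLink e x y ↔ ∃ a b, G.IsLink e a b ∧ f a ≠ f b ∧ f a = x ∧ f b = y := by
  have h : (consolidate f G).IsLink e x y ↔
      (G.map f).IsLink e x y ∧ e ∉ {e | ∃ x, (G.map f).IsLoopAt e x} := by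
    simp [consolidate]
  rw [h]
  constructor
  · rintro ⟨⟨a, b, hab, rfl, rfl⟩, hl⟩
    refine ⟨a, b, hab, fun heq => hl ⟨f a, a, b, hab, rfl, heq.symm⟩, rfl, rfl⟩
  · rintro ⟨a, b, hab, hne, rfl, rfl⟩
    refine ⟨hab.map f, ?_⟩
    rintro ⟨z, hz⟩
    have hz : (G.map f).IsLink e z z := hz
    rcases (hab.map f).eq_and_eq_or_eq_and_eq hz with ⟨h₁, h₂⟩ | ⟨h₁, h₂⟩ <;>
      exact hne (h₁.trans h₂.symm)

lemma edgeSet_consolidate_subset (f : α → γ) (G : Graph α β) : E(consolidate f G) ⊆ E(G) := by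
  intro e he
  obtain ⟨x, y, h⟩ := exists_isLink_of_mem_edgeSet he
  obtain ⟨a, b, hab, -⟩ := consolidate_isLink.1 h
  exact hab.edge_mem

lemma IsFiniteLoopless.consolidate (hG : G.IsFiniteLoopless) (f : α → γ) :
    (consolidate f G).IsFiniteLoopless where
  loopless := by
    refine ⟨fun e x h => ?_⟩
    obtain ⟨a, b, -, hne, h₁, h₂⟩ := consolidate_isLink.1 h
    exact hne (h₁.trans h₂.symm)
  finite_vertexSet := hG.finite_vertexSet.image f
  finite_edgeSet := hG.finite_edgeSet.subset (edgeSet_consolidate_subset f G)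

/-- An edge crossing the preimage of A has endpoints in different fibres, so consolidation does not
delete it. -/
lemma cut_preimage_subset (f : α → γ) (A : Set γ) :
    G.cut (f ⁻¹' A) ⊆ (consolidate f G).cut A := by
  rintro e ⟨x, y, h, hx, hy⟩
  exact ⟨f x, f y, consolidate_isLink.2 ⟨x, y, h, fun heq => hy (heq ▸ hx : f y ∈ A), rfl, rfl⟩,
    hx, hy⟩

end Consolidate

/-! ### Finding the torso with a large 3-center -/

section Main

variable {α β τ : Type*} {G : Graph α β}

namespace TreeCutDecomposition

lemma mem_side_iff (D : G.TreeCutDecomposition τ) {u v : τ} {x : α} (hx : x ∈ V(G)) :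
    x ∈ D.side u v ↔ D.node x ∈ treeSide D.tree u v := by
  simp only [side, bag, treeSide, Set.mem_iUnion]
  constructor
  · rintro ⟨t, ht, -, rfl⟩
    exact ht
  · intro h
    exact ⟨_, h, hx, rfl⟩

lemma ncard_cut_side_le_adhesion (D : G.TreeCutDecomposition τ) (hG : G.IsFiniteLoopless)
    {u v : τ} (huv : D.tree.Adj u v) : (G.cut (D.side u v)).ncard ≤ D.adhesion := by
  refine le_csSup ⟨E(G).ncard, ?_⟩ ⟨u, v, huv, rfl⟩
  rintro _ ⟨u, v, -, rfl⟩
  exact Set.ncard_le_ncard (cut_subset_edgeSet _ _) hG.finite_edgeSet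

lemma core_subset (D : G.TreeCutDecomposition τ) (t : τ) : D.core t ⊆ V(D.torso t) := by
  rintro _ ⟨x, ⟨hx, hxt⟩, rfl⟩
  exact ⟨x, hx, by simp [torsoMap, hxt]⟩

lemma threeCenterOrder_le_width [Finite τ] (D : G.TreeCutDecomposition τ) (t : τ) :
    (D.torso t).threeCenterOrder (D.core t) ≤ D.width :=
  (le_ciSup (f := fun t => (D.torso t).threeCenterOrder (D.core t))
    (Set.finite_range _).bddAbove t).trans (le_max_right _ _)

lemma torsoMap_eq_inl (D : G.TreeCutDecomposition τ) {t : τ} {x a : α}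
    (h : D.torsoMap t x = Sum.inl a) : x = a := by
  unfold torsoMap at h
  split_ifs at h
  exact Sum.inl_injective h

lemma torsoMap_eq_inr (D : G.TreeCutDecomposition τ) {t : τ} {x : α}
    {C : (D.tree.induce {t}ᶜ).ConnectedComponent} (h : D.torsoMap t x = Sum.inr C) :
    ∃ hx : D.node x ≠ t, (D.tree.induce {t}ᶜ).connectedComponentMk ⟨D.node x, hx⟩ = C := by
  unfold torsoMap at h
  split_ifs at h with hx
  exact ⟨hx, Sum.inr_injective h⟩

open Classical in
lemma le_width_of_immerses_wall [Finite τ] (D : G.TreeCutDecomposition τ)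
    (hG : G.IsFiniteLoopless) {r : ℕ} (hr : 3 ≤ r) (himm : G.Immerses (wall (2 * r ^ 2))) :
    r ≤ D.width := by
  by_contra! hlt
  obtain ⟨πv, πe, hπ⟩ := himm
  have hP := hπ.isEdgeImmersion
  have hM : 3 ≤ r ^ 2 := by nlinarith
  have hrM : r - 1 < r ^ 2 := by
    have : r ≤ r ^ 2 := by nlinarith
    omega
  have hV : ∀ k, πv (wallDiagonal (r ^ 2) k) ∈ V(G) := fun k =>
    hπ.mapsTo (wallDiagonal_mem (r ^ 2) k)
  let Big : τ → τ → Prop := fun u v => r - 1 < (Finset.univ.filter fun k =>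
    D.node (πv (wallDiagonal (r ^ 2) k)) ∈ treeSide D.tree u v).card
  obtain ⟨t, ht⟩ := exists_sink D.isTree Big (by
    intro u v huv hb hb'
    have hcut : ((wall (2 * r ^ 2)).cut (πv ⁻¹' D.side u v)).ncard ≤ r - 1 := by
      have h₁ := hP.ncard_cut_le hG.finite_edgeSet (A := πv ⁻¹' D.side u v) (B := D.side u v)
        fun x _ => Iff.rfl
      have h₂ := D.ncard_cut_side_le_adhesion hG huv
      have h₃ : D.adhesion ≤ D.width := le_max_left _ _
      omega
    rcases wall_cut_dichotomy hM _ hcut hrM with h | h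
    · refine h.not_gt (hb.trans_le (Finset.card_le_card fun k hk => ?_))
      rw [Finset.mem_filter] at hk ⊢
      exact ⟨hk.1, (D.mem_side_iff (hV k)).2 hk.2⟩
    · refine h.not_gt (hb'.trans_le (Finset.card_le_card fun k hk => ?_))
      rw [Finset.mem_filter] at hk ⊢
      exact ⟨hk.1, fun hk' => Set.disjoint_left.1 (disjoint_treeSide D.isTree huv)
        ((D.mem_side_iff (hV k)).1 hk') hk.2⟩)
  let φ : Fin (r ^ 2 - 2) → α ⊕ (D.tree.induce {t}ᶜ).ConnectedComponent :=
    fun k => D.torsoMap t (πv (wallDiagonal (r ^ 2) k))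
  have hfibre : ∀ c ∈ Finset.univ.image φ, (Finset.univ.filter fun k => φ k = c).card ≤ r - 1 := by
    rintro (a | C) -
    -- A vertex of the bag is its own fibre, so it is the image of at most one diagonal vertex.
    · refine (Finset.card_le_one.2 fun k hk l hl => ?_).trans (by omega : 1 ≤ r - 1)
      rw [Finset.mem_filter] at hk hl
      exact wallDiagonal_injective _ (hπ.injOn (wallDiagonal_mem _ k) (wallDiagonal_mem _ l)
        ((D.torsoMap_eq_inl hk.2).trans (D.torsoMap_eq_inl hl.2).symm))
    · obtain ⟨s, hts, hs⟩ := exists_component_subset_treeSide D.isTree t C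
      refine (Finset.card_le_card fun k hk => ?_).trans (not_lt.1 (ht s hts))
      rw [Finset.mem_filter] at hk ⊢
      obtain ⟨hx, hC⟩ := D.torsoMap_eq_inr hk.2
      exact ⟨hk.1, hs _ hx hC⟩
  have hcard := Finset.card_le_mul_card_image Finset.univ (r - 1) hfibre
  rw [Finset.card_univ, Fintype.card_fin] at hcard
  have hS : r ≤ (Finset.univ.image φ).card := by
    by_contra! hS
    -- With fewer than r images there would be at most q² diagonal vertices, but there are (q + 1)²
    -- - 2 = q² + 2q - 1 of them.
    obtain ⟨q, rfl⟩ : ∃ q, r = q + 1 := ⟨r - 1, by omega⟩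
    have h₁ : q * (Finset.univ.image φ).card ≤ q * q := Nat.mul_le_mul_left q (by omega)
    have h₂ : (q + 1) ^ 2 = q * q + 2 * q + 1 := by ring
    simp only [Nat.add_sub_cancel] at hcard
    omega
  have hle := ncard_le_threeCenterOrder (G := D.torso t) (hG.consolidate _) (D.core_subset t)
    (S := (Finset.univ.image φ : Finset _)) (by
      intro c hc
      obtain ⟨k, -, rfl⟩ := Finset.mem_image.1 hc
      exact ⟨_, hV k, rfl⟩) (by
      exact Finset.one_lt_card_iff_nontrivial.1 (by omega)) (by
      rintro A ⟨c, hc, hcA⟩ ⟨d, hd, hdA⟩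
      obtain ⟨k, -, rfl⟩ := Finset.mem_image.1 hc
      obtain ⟨l, -, rfl⟩ := Finset.mem_image.1 hd
      refine (three_le_ncard_wall_cut hM (A := πv ⁻¹' (D.torsoMap t ⁻¹' A)) hcA hdA).trans
        ((hP.ncard_cut_le hG.finite_edgeSet fun x _ => Iff.rfl).trans
          (Set.ncard_le_ncard (cut_preimage_subset _ A) ((hG.consolidate _).finite_cut A))))
  rw [Set.ncard_coe_finset] at hle
  have := D.threeCenterOrder_le_width t
  omega

end TreeCutDecomposition

end Main

end Graph

theorem mainTheorem2 {α β : Type*} (G : Graph α β) (hG : G.IsFiniteLoopless)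
    (r : ℕ) (hr : 3 ≤ r) (himm : G.Immerses (Graph.wall (2 * r ^ 2))) :
    r ≤ G.treeCutWidth := by
  refine le_csInf ?_ ?_
  -- The one-node decomposition shows that the infimum is not the default value `sInf ∅ = 0`.
  · exact ⟨_, Unit, inferInstance, ⟨⊥, SimpleGraph.IsTree.of_subsingleton, fun _ => ()⟩, rfl⟩
  · rintro _ ⟨τ, _, D, rfl⟩
    exact D.le_width_of_immerses_wall hG hr himm
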